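/- All logarithms are to base 2. A $\kappa$-gapped pattern over an alphabet $\Sigma$ is an expression $p_1\{\alpha_1,\beta_1\}p_2\{\alpha_2,\beta_2\}\cdots\{\alpha_\kappa,\beta_\kappa\}p_{\kappa+1}$ with nonempty strings $p_i$ over $\Sigma$ and integers $\alpha_i,\beta_i\ge 0$; it matches a document $T$ (a string over $\Sigma$) if one can choose an occurrence of each $p_i$ in $T$ such that, for $1\le i\le\kappa$, the number of characters between the end of the occurrence of $p_i$ and the start of that of $p_{i+1}$ is at least $\alpha_i$ and at most $\beta_i$. Its length is $\sum_i|p_i|$, and it is standard with gap $\gamma$ if $\alpha_i=0$ and $\beta_i=\gamma$ for all $i$. A pointer-machine data structure for a finite set (dictionary) $\mathcal S$ of patterns is a finite directed graph with a root in which every vertex (memory cell) has out-degree at most two and stores at most one pattern; its space is the number of vertices. It answers queries of length $D$ in time $q+Ct$ if for every document $T$ of length $D$, with $t$ the number of patterns in $\mathcal S$ that match $T$, there is a set of at most $q+Ct$ vertices that contains the root, in which every vertex is reachable from the root by edges inside the set, and whose vertices together store all patterns of $\mathcal S$ that match $T$. **Theorem.** There is an absolute constant $c>0$ such that the following holds.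 Let $\Sigma$ be a finite alphabet with at least three letters, let $C$ and $0<a\le b<1$ be real constants, and let $\kappa=\kappa(n)\ge1$, $\gamma=\gamma(n)\ge1$, $D=D(n)$ be integers with $$\kappa=o\!\left(\frac{\log\log n}{\log\log\log n}\right),\qquad n^{a/(\kappa+1)}\le D\le n^{b/(\kappa+1)},\qquad 2\kappa\gamma\le D$$ (the inequalities being required for all sufficiently large $n$). Let $q=q(n)$ satisfy $$q=o\!\left(\frac{D\,\gamma^{\kappa}}{(2+2\log D)^{\kappa+1}}\right)\qquad(n\to\infty).$$ Then for all sufficiently large $n$ there is a dictionary of standard $\kappa$-gapped patterns over $\Sigma$ with gap $\gamma$ and total length exactly $n$ such that every pointer-machine data structure for this dictionary that answers queries of length $D$ in time $q+Ct$ uses at least $n^{\,c\,\log^{1/(2\kappa)}n}$ space. -/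

import Mathlib

open Filter Asymptotics

/-- A `κ`-gapped pattern `p₁{α₁,β₁} p₂{α₂,β₂} ⋯ {α_κ,β_κ} p_{κ+1}` over the alphabet `A`:
`κ + 1` nonempty strings and, between consecutive strings, a lower bound `lo i` and an upper
bound `hi i` on the number of characters in the gap. -/
@[ext]
structure GappedPattern (A : Type*) (κ : ℕ) where
  part : Fin (κ + 1) → List A
  part_ne_nil : ∀ i, part i ≠ []
  lo : Fin κ → ℕ
  hi : Fin κ → ℕ

namespace GappedPattern

variable {A : Type*} {κ : ℕ}

/-- The pattern matches the document `T` if one can choose a starting position `pos i` of an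
occurrence in `T` of every subpattern, such that the number of characters between the end of
the `i`-th occurrence and the start of the next one is at least `lo i` and at most `hi i`. -/
def Matches (P : GappedPattern A κ) (T : List A) : Prop :=
  ∃ pos : Fin (κ + 1) → ℕ,
    (∀ i, P.part i <+: T.drop (pos i)) ∧
    ∀ i : Fin κ,
      pos i.castSucc + (P.part i.castSucc).length + P.lo i ≤ pos i.succ ∧
      pos i.succ ≤ pos i.castSucc + (P.part i.castSucc).length + P.hi i

/-- Standard patterns: every gap has between `0` and `γ` characters. -/
def IsStandard (γ : ℕ) (P : GappedPattern A κ) : Prop :=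
  ∀ i, P.lo i = 0 ∧ P.hi i = γ

/-- The number of characters of a pattern. -/
def length (P : GappedPattern A κ) : ℕ := ∑ i, (P.part i).length

end GappedPattern

/-- The answer to a gapped pattern indexing query: the patterns of the dictionary that match
the query document. -/
noncomputable def gpiOutput {A : Type*} {κ : ℕ} (dict : Finset (GappedPattern A κ))
    (T : List A) : Finset (GappedPattern A κ) :=
  open Classical in dict.filter fun P => P.Matches T

/-- A pointer-machine data structure over the universe `U`: a finite directed graph with a
root, in which every vertex (memory cell) has at most two outgoing edges (pointers) and
stores at most one element of `U`. Its space is the number of its cells. -/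
structure PointerStructure (U : Type*) where
  size : ℕ
  root : Fin size
  next : Fin size → Fin 2 → Option (Fin size)
  label : Fin size → Option U

namespace PointerStructure

variable {U : Type*}

/-- There is a pointer from the cell `v` to the cell `w`. -/
def Edge (G : PointerStructure U) (v w : Fin G.size) : Prop :=
  ∃ b : Fin 2, G.next v b = some w

/-- `W` can be explored from the root: it contains the root, and each of its cells is reached
from the root by following pointers between cells of `W`. -/
def Explorable (G : PointerStructure U) (W : Finset (Fin G.size)) : Prop :=
  G.root ∈ W ∧
    ∀ v ∈ W, Relation.ReflTransGen (fun x y => x ∈ W ∧ y ∈ W ∧ G.Edge x y) G.root v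

/-- The set `out` can be reported in the given time: some explorable set of at most `time`
cells stores all the elements of `out`. -/
def Reports (G : PointerStructure U) (out : Finset U) (time : ℝ) : Prop :=
  ∃ W : Finset (Fin G.size), G.Explorable W ∧
    (∀ u ∈ out, ∃ v ∈ W, G.label v = some u) ∧ (W.card : ℝ) ≤ time

/-- For every query document of length `D`, the structure reports the `t` matching patterns of
the dictionary in time at most `q + C * t`. -/
def AnswersGPI {A : Type*} {κ : ℕ} (G : PointerStructure (GappedPattern A κ))
    (dict : Finset (GappedPattern A κ)) (D : ℕ) (q C : ℝ) : Prop :=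
  ∀ T : List A, T.length = D →
    G.Reports (gpiOutput dict T) (q + C * ((gpiOutput dict T).card : ℝ))

end PointerStructure

/-! The proof counts documents. A function `f : Fin N → Fin M` is spelled as a document whose `i`-th
block is the code word of `(i, f i)`, and the dictionary has one pattern for every `(κ + 1)`-tuple
of code words. Each gap leaves about `γ / B` choices for the next block, `B` being the block length,
so every such document has many outputs (`le_card_gpiOutput`): enough to dominate `q`, so that a
query costs at most `K` cells per output. Yet `r ^ (κ + 1)` common outputs prescribe `f` at `r` or
more points, so at most `M ^ (N - r)` documents share them (`card_filter_subset_gpiOutput_le`).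

A query explores a connected set of cells, hence the unfolding of a binary tree. With `K` cells per
output, some subtree of at most `4 * K * β` nodes stores more than `β = r ^ (κ + 1)` outputs
(`exists_dense_piece`). A piece is determined by its first cell and its shape, so small pieces are
few, and each set of `β` patterns in them serves few of the `M ^ N` documents (`card_le_size_mul`).
Hence the size is at least `M ^ r / 2 ^ O(K r ^ (κ + 1))` (`exists_hard_dictionary`).

Write `Λ = log n`. With `M` about `D ^ ε`, `log M` is at least of order `Λ / log Λ`. For `r = ⌊Λ ^
(3 / (4κ))⌋` the loss is of lower order because `r ^ κ ≤ Λ ^ (3/4)`, while up to rounding `r`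
exceeds `Λ ^ (1 / (2κ))` by the factor `Λ ^ (1 / (4κ))`. The growth condition on `κ` makes this
factor at least `(log Λ) ^ 2`, which absorbs the remaining losses and even gives `c = 1`. -/

/-! ### Explored sets as unfoldings of binary trees -/

theorem card_treesOfNumNodesEq_le (n : ℕ) :
    (BinaryTree.treesOfNumNodesEq n).card ≤ 4 ^ n := by
  rw [BinaryTree.treesOfNumNodesEq_card_eq_catalan, catalan_eq_centralBinom_div]
  exact (Nat.div_le_self _ _).trans (Nat.centralBinom_le_four_pow n)

/-- The binary trees with at most `n` nodes. -/
def treesOfNumNodesLE (n : ℕ) : Finset (BinaryTree Unit) :=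
  (Finset.range (n + 1)).biUnion BinaryTree.treesOfNumNodesEq

theorem mem_treesOfNumNodesLE {n : ℕ} {t : BinaryTree Unit} :
    t ∈ treesOfNumNodesLE n ↔ t.numNodes ≤ n := by
  simp [treesOfNumNodesLE, BinaryTree.mem_treesOfNumNodesEq]

theorem card_treesOfNumNodesLE_le (n : ℕ) : (treesOfNumNodesLE n).card ≤ 4 ^ (n + 1) := by
  refine Finset.card_biUnion_le.trans ((Finset.sum_le_sum
    fun i _ => card_treesOfNumNodesEq_le i).trans ?_)
  exact (Nat.geomSum_lt (by norm_num) fun i hi => Finset.mem_range.1 hi).le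

namespace PointerStructure

variable {U : Type*}

/-- The cells visited when a binary tree is unfolded along the pointers from a given cell. -/
def cells (G : PointerStructure U) :
    BinaryTree Unit → Option (Fin G.size) → Finset (Fin G.size)
  | .nil, _ => ∅
  | .node _ _ _, none => ∅
  | .node _ l r, some v => insert v (G.cells l (G.next v 0) ∪ G.cells r (G.next v 1))

theorem cells_none (G : PointerStructure U) (t : BinaryTree Unit) : G.cells t none = ∅ := by
  cases t <;> rfl

theorem card_cells_le (G : PointerStructure U) (t : BinaryTree Unit) (o : Option (Fin G.size)) :
    (G.cells t o).card ≤ t.numNodes := by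
  induction t generalizing o with
  | nil => simp [cells]
  | node u l r hl hr =>
    cases o with
    | none => simp [cells]
    | some v =>
      have h1 := Finset.card_insert_le v (G.cells l (G.next v 0) ∪ G.cells r (G.next v 1))
      have h2 := Finset.card_union_le (G.cells l (G.next v 0)) (G.cells r (G.next v 1))
      have h3 := hl (G.next v 0)
      have h4 := hr (G.next v 1)
      simp only [cells, BinaryTree.numNodes]
      omega

/-- Where the unfolding visits `x`, the subtree behind the pointer to `w` must be empty, since
otherwise `w` would be visited. A leaf can be hung there. -/
theorem exists_cells_eq_insert (G : PointerStructure U) (t : BinaryTree Unit)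
    (o : Option (Fin G.size)) {x w : Fin G.size} (hx : x ∈ G.cells t o) (hxw : G.Edge x w)
    (hw : w ∉ G.cells t o) :
    ∃ t' : BinaryTree Unit, t'.numNodes = t.numNodes + 1 ∧
      G.cells t' o = insert w (G.cells t o) := by
  obtain ⟨b, hb⟩ := hxw
  induction t generalizing o with
  | nil => simp [cells] at hx
  | node u l r hl hr =>
    cases o with
    | none => simp [cells] at hx
    | some v =>
      simp only [cells, Finset.mem_insert, Finset.mem_union, not_or] at hx hw
      have key : ∀ (s : BinaryTree Unit), w ∉ G.cells s (some w) → s = .nil := by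
        intro s hs
        cases s with
        | nil => rfl
        | node _ _ _ => simp [cells] at hs
      rcases hx with rfl | hx | hx
      · have h01 : b = 0 ∨ b = 1 := by omega
        rcases h01 with rfl | rfl
        · have hnil : l = .nil := key l (hb ▸ hw.2.1)
          subst hnil
          refine ⟨.node () (.node () .nil .nil) r, by simp only [BinaryTree.numNodes]; omega, ?_⟩
          ext y
          simp only [cells, hb, Finset.mem_insert, Finset.mem_union, Finset.notMem_empty]
          tauto
        · have hnil : r = .nil := key r (hb ▸ hw.2.2)
          subst hnil
          refine ⟨.node () l (.node () .nil .nil), by simp [BinaryTree.numNodes], ?_⟩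
          ext y
          simp only [cells, hb, Finset.mem_insert, Finset.mem_union, Finset.notMem_empty]
          tauto
      · obtain ⟨l', h1, h2⟩ := hl _ hx hw.2.1
        refine ⟨.node () l' r, by simp only [BinaryTree.numNodes]; omega, ?_⟩
        ext y
        simp only [cells, h2, Finset.mem_insert, Finset.mem_union]
        tauto
      · obtain ⟨r', h1, h2⟩ := hr _ hx hw.2.2
        refine ⟨.node () l r', by simp only [BinaryTree.numNodes]; omega, ?_⟩
        ext y
        simp only [cells, h2, Finset.mem_insert, Finset.mem_union]
        tauto

/-- As long as cells of `W` are missing, reachability inside `W` gives a pointer leaving the visited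
cells; following it adds one node and one new cell. -/
theorem Explorable.exists_cells_eq {G : PointerStructure U} {W : Finset (Fin G.size)}
    (hW : G.Explorable W) :
    ∃ t : BinaryTree Unit, t.numNodes = W.card ∧ G.cells t (some G.root) = W := by
  obtain ⟨hroot, hreach⟩ := hW
  have hpos : 0 < W.card := Finset.card_pos.2 ⟨_, hroot⟩
  have main : ∀ k, k + 1 ≤ W.card → ∃ t : BinaryTree Unit, t.numNodes = k + 1 ∧
      G.cells t (some G.root) ⊆ W ∧ (G.cells t (some G.root)).card = k + 1 ∧
      G.root ∈ G.cells t (some G.root) := by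
    intro k
    induction k with
    | zero =>
      intro _
      exact ⟨.node () .nil .nil, by simp, by simpa [cells] using hroot, by simp [cells],
        by simp [cells]⟩
    | succ k ih =>
      intro hk
      obtain ⟨t, h1, h2, h3, h4⟩ := ih (by omega)
      obtain ⟨x, w, hx, hw, hwW, he⟩ : ∃ x w, x ∈ G.cells t (some G.root) ∧
          w ∉ G.cells t (some G.root) ∧ w ∈ W ∧ G.Edge x w := by
        by_contra! hcon
        have hall : ∀ y ∈ W, y ∈ G.cells t (some G.root) := by
          intro y hy
          induction hreach y hy with
          | refl => exact h4
          | tail _ hbc ih' =>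
            by_contra hc
            exact hcon _ _ (ih' hbc.1) hc hbc.2.1 hbc.2.2
        have := Finset.card_le_card hall
        omega
      obtain ⟨t', h5, h6⟩ := G.exists_cells_eq_insert t _ hx he hw
      refine ⟨t', by omega, ?_, ?_, ?_⟩
      · rw [h6]
        exact Finset.insert_subset hwW h2
      · rw [h6, Finset.card_insert_of_notMem hw, h3]
      · rw [h6]
        exact Finset.mem_insert_of_mem h4
  obtain ⟨t, h1, h2, h3, -⟩ := main (W.card - 1) (by omega)
  exact ⟨t, by omega, Finset.eq_of_subset_of_card_le h2 (by omega)⟩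

/-! ### Dense pieces and the counting bound -/

open Classical in
/-- The elements stored in the cells of `X`. -/
noncomputable def stored (G : PointerStructure U) (X : Finset (Fin G.size)) : Finset U :=
  X.biUnion fun v => (G.label v).toFinset

theorem mem_stored {G : PointerStructure U} {X : Finset (Fin G.size)} {u : U} :
    u ∈ G.stored X ↔ ∃ v ∈ X, G.label v = some u := by
  simp [stored]

theorem card_stored_le (G : PointerStructure U) (X : Finset (Fin G.size)) :
    (G.stored X).card ≤ X.card := by
  classical
  rw [stored]
  refine Finset.card_biUnion_le.trans ?_
  rw [Finset.card_eq_sum_ones]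
  refine Finset.sum_le_sum fun v _ => ?_
  cases G.label v <;> simp

-- Cut the tree bottom-up, removing a subtree as soon as it has `h` nodes. Here `j` counts the
-- removed pieces, `E` collects their elements of `O`, and `t₀` is what remains at the root.
open Classical in
theorem exists_remainder (G : PointerStructure U) (O : Finset U) {h β : ℕ} (hh : 1 ≤ h)
    (hβ : ∀ (t : BinaryTree Unit) (o : Option (Fin G.size)), t.numNodes ≤ 2 * h →
      (O ∩ G.stored (G.cells t o)).card ≤ β)
    (t : BinaryTree Unit) (o : Option (Fin G.size)) :
    ∃ (t₀ : BinaryTree Unit) (j : ℕ) (E : Finset U), t₀.numNodes < h ∧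
      h * j + t₀.numNodes ≤ t.numNodes ∧ E.card ≤ β * j ∧
      O ∩ G.stored (G.cells t o) ⊆ (O ∩ G.stored (G.cells t₀ o)) ∪ E := by
  induction t generalizing o with
  | nil => exact ⟨.nil, 0, ∅, hh, by simp, by simp, by simp⟩
  | node u l r hl hr =>
    cases o with
    | none => exact ⟨.nil, 0, ∅, hh, by simp, by simp, by simp [cells_none]⟩
    | some v =>
      obtain ⟨l₀, jl, El, h1, h2, h3, h4⟩ := hl (G.next v 0)
      obtain ⟨r₀, jr, Er, h5, h6, h7, h8⟩ := hr (G.next v 1)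
      have hsub : O ∩ G.stored (G.cells (.node u l r) (some v)) ⊆
          (O ∩ G.stored (G.cells (.node u l₀ r₀) (some v))) ∪ (El ∪ Er) := by
        intro y hy
        obtain ⟨hyO, hy⟩ := Finset.mem_inter.1 hy
        obtain ⟨z, hz, hlab⟩ := mem_stored.1 hy
        simp only [cells, Finset.mem_insert, Finset.mem_union] at hz
        have hnew : ∀ x, x ∈ G.cells (.node u l₀ r₀) (some v) → G.label x = some y →
            y ∈ O ∩ G.stored (G.cells (.node u l₀ r₀) (some v)) := fun x hx hxy =>
          Finset.mem_inter.2 ⟨hyO, mem_stored.2 ⟨x, hx, hxy⟩⟩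
        rcases hz with rfl | hz | hz
        · exact Finset.mem_union_left _ (hnew z (by simp [cells]) hlab)
        · have := h4 (Finset.mem_inter.2 ⟨hyO, mem_stored.2 ⟨z, hz, hlab⟩⟩)
          rcases Finset.mem_union.1 this with h | h
          · obtain ⟨x, hx, hxy⟩ := mem_stored.1 (Finset.mem_inter.1 h).2
            exact Finset.mem_union_left _ (hnew x (by simp [cells, hx]) hxy)
          · exact Finset.mem_union_right _ (Finset.mem_union_left _ h)
        · have := h8 (Finset.mem_inter.2 ⟨hyO, mem_stored.2 ⟨z, hz, hlab⟩⟩)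
          rcases Finset.mem_union.1 this with h | h
          · obtain ⟨x, hx, hxy⟩ := mem_stored.1 (Finset.mem_inter.1 h).2
            exact Finset.mem_union_left _ (hnew x (by simp [cells, hx]) hxy)
          · exact Finset.mem_union_right _ (Finset.mem_union_right _ h)
      have hE := Finset.card_union_le El Er
      by_cases hsmall : (BinaryTree.node u l₀ r₀).numNodes < h
      · refine ⟨_, jl + jr, El ∪ Er, hsmall, ?_, ?_, hsub⟩
        · simp only [BinaryTree.numNodes]
          rw [mul_add]
          omega
        · rw [mul_add]
          omega
      -- Both remainders have fewer than `h` nodes, so the piece cut off here has at least `h` and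
      -- at most `2 * h - 1` nodes.
      · refine ⟨.nil, jl + jr + 1,
          (O ∩ G.stored (G.cells (.node u l₀ r₀) (some v))) ∪ (El ∪ Er),
          hh, ?_, ?_, hsub.trans (Finset.subset_union_right)⟩
        · simp only [BinaryTree.numNodes] at hsmall ⊢
          rw [mul_add, mul_add]
          omega
        · have h9 := hβ (.node u l₀ r₀) (some v) (by simp only [BinaryTree.numNodes]; omega)
          have h10 := Finset.card_union_le
            (O ∩ G.stored (G.cells (.node u l₀ r₀) (some v))) (El ∪ Er)
          rw [mul_add, mul_add]
          omega

open Classical in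
/-- A set that is reported in linear time has a small piece of the explored part of the
structure that stores many of its elements. -/
theorem exists_dense_piece (G : PointerStructure U) {O : Finset U} {W : Finset (Fin G.size)}
    (hW : G.Explorable W) (hO : ∀ u ∈ O, ∃ v ∈ W, G.label v = some u) {K β : ℕ}
    (hK : 1 ≤ K) (hβ : 1 ≤ β) (hWO : W.card ≤ K * O.card) (hOβ : 2 * β < O.card) :
    ∃ (t : BinaryTree Unit) (v : Fin G.size), t.numNodes ≤ 4 * K * β ∧
      β < (O ∩ G.stored (G.cells t (some v))).card := by
  suffices hs : ∃ (t : BinaryTree Unit) (o : Option (Fin G.size)),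
      t.numNodes ≤ 2 * (2 * K * β) ∧ β < (O ∩ G.stored (G.cells t o)).card by
    obtain ⟨t, o, h1, h2⟩ := hs
    cases o with
    | none => simp [cells_none, stored] at h2
    | some v => exact ⟨t, v, by linarith, h2⟩
  by_contra! hcon
  -- With `h = 2 * K * β` there are at most `|O| / (2 * β)` pieces. If none is dense, they hold at
  -- most half of `O` and the remainder at most `β`, contradicting `2 * β < |O|`.
  have hpos : 1 ≤ 2 * K * β := Nat.one_le_iff_ne_zero.2 (by positivity)
  obtain ⟨t, ht, htW⟩ := hW.exists_cells_eq
  obtain ⟨t₀, j, E, h1, h2, h3, h4⟩ := G.exists_remainder O hpos hcon t (some G.root)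
  have h5 : O ⊆ O ∩ G.stored (G.cells t (some G.root)) := fun u hu =>
    Finset.mem_inter.2 ⟨hu, mem_stored.2 (htW ▸ hO u hu)⟩
  have h6 := (Finset.card_le_card (h5.trans h4)).trans (Finset.card_union_le _ _)
  have h7 := hcon t₀ (some G.root) (by omega)
  have h8 : 2 * (β * j) * K ≤ O.card * K := by nlinarith
  have h9 := Nat.le_of_mul_le_mul_right h8 hK
  omega

open Classical in
/-- If every one of a family of outputs has a small dense piece and few outputs have many
elements in common, then the structure is large. -/
theorem card_le_size_mul (G : PointerStructure U) {F : Type*} [Fintype F] (out : F → Finset U)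
    {β k Q : ℕ}
    (hpiece : ∀ f, ∃ (t : BinaryTree Unit) (v : Fin G.size), t.numNodes ≤ k ∧
      β ≤ (out f ∩ G.stored (G.cells t (some v))).card)
    (hinter : ∀ B : Finset U, β ≤ B.card →
      (Finset.univ.filter fun f => B ⊆ out f).card ≤ Q) :
    Fintype.card F ≤ G.size * 4 ^ (k + 1) * (2 ^ k * Q) := by
  let I : Finset (Fin G.size × BinaryTree Unit) := Finset.univ ×ˢ treesOfNumNodesLE k
  let P : Fin G.size × BinaryTree Unit → Finset (Finset U) := fun p =>
    (G.stored (G.cells p.2 (some p.1))).powerset.filter fun B => β ≤ B.card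
  let H : Finset U → Finset F := fun B => Finset.univ.filter fun f => B ⊆ out f
  -- Each `f` is charged to its dense piece and to the part of its output stored there.
  have hcover : (Finset.univ : Finset F) ⊆ I.biUnion fun p => (P p).biUnion H := by
    intro f _
    obtain ⟨t, v, ht, hf⟩ := hpiece f
    refine Finset.mem_biUnion.2 ⟨(v, t), ?_, Finset.mem_biUnion.2
      ⟨out f ∩ G.stored (G.cells t (some v)), ?_, ?_⟩⟩
    · exact Finset.mem_product.2 ⟨Finset.mem_univ _, mem_treesOfNumNodesLE.2 ht⟩
    · exact Finset.mem_filter.2 ⟨Finset.mem_powerset.2 Finset.inter_subset_right, hf⟩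
    · exact Finset.mem_filter.2 ⟨Finset.mem_univ _, Finset.inter_subset_left⟩
  have hP : ∀ p ∈ I, ((P p).biUnion H).card ≤ 2 ^ k * Q := by
    intro p hp
    have hp2 : p.2.numNodes ≤ k := mem_treesOfNumNodesLE.1 (Finset.mem_product.1 hp).2
    have hcard : (P p).card ≤ 2 ^ k := by
      refine (Finset.card_filter_le _ _).trans ?_
      rw [Finset.card_powerset]
      exact Nat.pow_le_pow_right (by norm_num)
        ((G.card_stored_le _).trans ((G.card_cells_le _ _).trans hp2))
    refine (Finset.card_biUnion_le_card_mul _ _ Q fun B hB =>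
      hinter B (Finset.mem_filter.1 hB).2).trans ?_
    exact Nat.mul_le_mul_right _ hcard
  have hI : I.card ≤ G.size * 4 ^ (k + 1) := by
    simp only [I, Finset.card_product, Finset.card_univ, Fintype.card_fin]
    exact Nat.mul_le_mul_left _ (card_treesOfNumNodesLE_le k)
  calc Fintype.card F = (Finset.univ : Finset F).card := rfl
    _ ≤ _ := Finset.card_le_card hcover
    _ ≤ I.card * (2 ^ k * Q) := Finset.card_biUnion_le_card_mul _ _ _ hP
    _ ≤ _ := Nat.mul_le_mul_right _ hI

end PointerStructure

/-! ### Documents, patterns and the dictionary -/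

/-- A code for pairs of numbers by words over three letters: every code word consists of a
marker followed by `L` letters other than the marker. -/
theorem exists_marked_code {A : Type*} [Fintype A] (hA : 3 ≤ Fintype.card A) {N M L : ℕ}
    (hNM : N * M ≤ 2 ^ L) :
    ∃ (m z : A) (letter : Fin N × Fin M → ℕ → A), z ≠ m ∧ (∀ x, letter x 0 = m) ∧
      (∀ x j, letter x (j + 1) ≠ m) ∧
      ∀ x y, (∀ j < L + 1, letter x j = letter y j) → x = y := by
  obtain ⟨m, z, y, hmz, hmy, hzy⟩ := Fintype.two_lt_card_iff.1 hA
  -- After the marker come the binary digits of the index of `x`, written with the two other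
  -- letters.
  refine ⟨m, z, fun x j => Nat.casesOn j m
    (fun i => if ((finProdFinEquiv x : Fin (N * M)) : ℕ).testBit i then z else y), hmz.symm,
    fun x => rfl, fun x j => ?_, fun x x' h => ?_⟩
  · dsimp only
    split_ifs
    · exact hmz.symm
    · exact hmy.symm
  · refine finProdFinEquiv.injective (Fin.ext (Nat.eq_of_testBit_eq fun i => ?_))
    by_cases hi : i < L
    · have := h (i + 1) (by omega)
      dsimp only at this
      split_ifs at this with h1 h2 h2
      · rw [h1, h2]
      · exact absurd this hzy
      · exact absurd this.symm hzy
      · simp only [Bool.not_eq_true] at h1 h2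
        rw [h1, h2]
    · have hlt : ∀ x : Fin (N * M), (x : ℕ) < 2 ^ i := fun x =>
        (x.2.trans_le hNM).trans_le (Nat.pow_le_pow_right (by norm_num) (by omega))
      rw [Nat.testBit_eq_false_of_lt (hlt _), Nat.testBit_eq_false_of_lt (hlt _)]

/-- A code for the elements of `Fin N × Fin M` by words of length `B` that start with a marker
which occurs nowhere else in the code words, and a filler letter other than the marker. -/
structure MarkedCode (A : Type*) (N M B : ℕ) where
  marker : A
  filler : A
  letter : Fin N × Fin M → ℕ → A
  filler_ne : filler ≠ marker
  letter_zero : ∀ x, letter x 0 = marker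
  letter_succ_ne : ∀ x j, letter x (j + 1) ≠ marker
  letter_inj : ∀ x y, (∀ j < B, letter x j = letter y j) → x = y
  pos : 0 < B

namespace MarkedCode

variable {A : Type*} {N M B : ℕ} (c : MarkedCode A N M B)

/-- The code word of `x`. -/
def block (x : Fin N × Fin M) : List A := (List.range B).map (c.letter x)

theorem length_block (x : Fin N × Fin M) : (c.block x).length = B := by simp [block]

theorem block_ne_nil (x : Fin N × Fin M) : c.block x ≠ [] := by
  have := c.pos
  rw [← List.length_pos_iff, length_block]
  exact this

theorem block_injective : Function.Injective c.block := by
  intro x y h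
  refine c.letter_inj x y fun j hj => ?_
  have := List.map_inj_left.1 h j (List.mem_range.2 hj)
  exact this

/-- The letter at position `p` of the document that spells the graph of `f`. -/
def docLetter (f : Fin N → Fin M) (p : ℕ) : A :=
  if h : p / B < N then c.letter (⟨p / B, h⟩, f ⟨p / B, h⟩) (p % B) else c.filler

/-- The document of length `D` that consists of the code words of the pairs `(i, f i)` and is
filled up with the filler letter. -/
def doc (D : ℕ) (f : Fin N → Fin M) : List A := (List.range D).map (c.docLetter f)

theorem length_doc (D : ℕ) (f : Fin N → Fin M) : (c.doc D f).length = D := by simp [doc]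

theorem block_prefix_drop_doc_iff {D : ℕ} {f : Fin N → Fin M} {x : Fin N × Fin M} {p : ℕ} :
    c.block x <+: (c.doc D f).drop p ↔
      p + B ≤ D ∧ ∀ j < B, c.docLetter f (p + j) = c.letter x j := by
  have hB := c.pos
  rw [List.prefix_iff_getElem]
  constructor
  · rintro ⟨h, h'⟩
    simp only [block, doc, List.length_map, List.length_range, List.length_drop] at h
    refine ⟨by omega, fun j hj => ?_⟩
    have := h' j (by simpa [block] using hj)
    simpa [block, doc] using this.symm
  · rintro ⟨h, h'⟩
    refine ⟨by simp only [block, doc, List.length_map, List.length_range, List.length_drop]; omega,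
      fun j hj => ?_⟩
    simp only [block, List.length_map, List.length_range] at hj
    simpa [block, doc] using (h' j hj).symm

/-- The marker occurs in the document only at block starts, so an occurrence of a code word is
aligned with a block and equals it. -/
theorem apply_eq_of_prefix {D : ℕ} {f : Fin N → Fin M} {x : Fin N × Fin M} {p : ℕ}
    (h : c.block x <+: (c.doc D f).drop p) : f x.1 = x.2 := by
  have hB := c.pos
  obtain ⟨-, h⟩ := c.block_prefix_drop_doc_iff.1 h
  have h0 := h 0 hB
  rw [c.letter_zero, add_zero, docLetter] at h0
  split_ifs at h0 with hp
  · have hmod : p % B = 0 := by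
      by_contra hne
      obtain ⟨j, hj⟩ := Nat.exists_eq_succ_of_ne_zero hne
      rw [hj] at h0
      exact c.letter_succ_ne _ _ h0
    obtain ⟨i, rfl⟩ := Nat.dvd_of_mod_eq_zero hmod
    rw [Nat.mul_div_cancel_left _ hB] at hp
    have hx : ((⟨i, hp⟩ : Fin N), f ⟨i, hp⟩) = x := by
      refine c.letter_inj _ _ fun j hj => ?_
      have hdiv : (B * i + j) / B = i := by
        rw [Nat.mul_add_div hB, Nat.div_eq_of_lt hj, add_zero]
      have hm : (B * i + j) % B = j := by
        rw [Nat.mul_add_mod, Nat.mod_eq_of_lt hj]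
      rw [← h j hj, docLetter, dif_pos (by rw [hdiv]; exact hp)]
      simp only [hdiv, hm]
    rw [← hx]
  · exact absurd h0 c.filler_ne

theorem block_prefix_drop_doc {D : ℕ} (hD : N * B ≤ D) (f : Fin N → Fin M) (i : Fin N) :
    c.block (i, f i) <+: (c.doc D f).drop (i * B) := by
  have hB := c.pos
  refine c.block_prefix_drop_doc_iff.2 ⟨?_, fun j hj => ?_⟩
  · have : (i.1 + 1) * B ≤ N * B := Nat.mul_le_mul_right _ i.2
    rw [add_mul] at this
    omega
  · have hdiv : (i * B + j) / B = i := by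
      rw [mul_comm, Nat.mul_add_div hB, Nat.div_eq_of_lt hj, add_zero]
    have hm : (i * B + j) % B = j := by
      rw [mul_comm, Nat.mul_add_mod, Nat.mod_eq_of_lt hj]
    rw [docLetter, dif_pos (by rw [hdiv]; exact i.2)]
    simp only [hdiv, hm]

/-- The standard pattern whose parts are the code words of a tuple. -/
def pattern {κ : ℕ} (γ : ℕ) (w : Fin (κ + 1) → Fin N × Fin M) : GappedPattern A κ where
  part i := c.block (w i)
  part_ne_nil i := c.block_ne_nil (w i)
  lo _ := 0
  hi _ := γ

theorem pattern_injective {κ : ℕ} (γ : ℕ) :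
    Function.Injective (c.pattern γ : (Fin (κ + 1) → Fin N × Fin M) → GappedPattern A κ) := by
  intro w w' h
  funext i
  exact c.block_injective (congrFun (congrArg GappedPattern.part h) i)

theorem length_pattern {κ : ℕ} (γ : ℕ) (w : Fin (κ + 1) → Fin N × Fin M) :
    (c.pattern γ w).length = (κ + 1) * B := by
  simp [GappedPattern.length, pattern, length_block]

theorem apply_eq_of_matches {κ γ D : ℕ} {f : Fin N → Fin M} {w : Fin (κ + 1) → Fin N × Fin M}
    (h : (c.pattern γ w).Matches (c.doc D f)) (i : Fin (κ + 1)) : f (w i).1 = (w i).2 := by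
  obtain ⟨pos, hpos, -⟩ := h
  exact c.apply_eq_of_prefix (hpos i)

theorem pattern_matches_doc {κ γ D : ℕ} (hD : N * B ≤ D) (f : Fin N → Fin M)
    (p : Fin (κ + 1) → Fin N)
    (hlo : ∀ i : Fin κ, (p i.castSucc : ℕ) + 1 ≤ p i.succ)
    (hhi : ∀ i : Fin κ, (p i.succ : ℕ) * B ≤ p i.castSucc * B + B + γ) :
    (c.pattern γ fun i => (p i, f (p i))).Matches (c.doc D f) := by
  refine ⟨fun i => p i * B, fun i => c.block_prefix_drop_doc hD f (p i), fun i => ?_⟩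
  simp only [pattern, length_block]
  refine ⟨?_, hhi i⟩
  have := Nat.mul_le_mul_right B (hlo i)
  rw [add_mul, one_mul] at this
  omega

/-- A pattern with a first part of length `k + 1` and other parts of length one. -/
def longPattern (κ γ k : ℕ) : GappedPattern A κ where
  part i := if i = 0 then List.replicate (k + 1) c.marker else [c.marker]
  part_ne_nil i := by split_ifs <;> simp
  lo _ := 0
  hi _ := γ

theorem length_longPattern (κ γ k : ℕ) : (c.longPattern κ γ k).length = k + 1 + κ := by
  simp [GappedPattern.length, longPattern, Fin.sum_univ_succ]

theorem not_longPattern_matches {κ γ k : ℕ} {T : List A} (hT : T.length ≤ k) :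
    ¬ (c.longPattern κ γ k).Matches T := by
  rintro ⟨pos, hpos, -⟩
  have := (hpos 0).length_le
  simp [longPattern] at this
  omega

open Classical in
/-- All patterns of code words together with one long pattern. -/
noncomputable def dict (κ γ k : ℕ) : Finset (GappedPattern A κ) :=
  insert (c.longPattern κ γ k) (Finset.univ.image (c.pattern γ))

theorem isStandard_of_mem_dict {κ γ k : ℕ} {P : GappedPattern A κ} (hP : P ∈ c.dict κ γ k) :
    P.IsStandard γ := by
  classical
  rcases Finset.mem_insert.1 hP with rfl | hP
  · exact fun i => ⟨rfl, rfl⟩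
  · obtain ⟨w, -, rfl⟩ := Finset.mem_image.1 hP
    exact fun i => ⟨rfl, rfl⟩

theorem sum_length_dict {κ γ k : ℕ} (hk : B ≤ k) :
    ∑ P ∈ c.dict κ γ k, P.length = (N * M) ^ (κ + 1) * ((κ + 1) * B) + (k + 1 + κ) := by
  classical
  have hnot : c.longPattern κ γ k ∉ Finset.univ.image (c.pattern γ) := by
    intro h
    obtain ⟨w, -, hw⟩ := Finset.mem_image.1 h
    have := congrArg List.length (congrFun (congrArg GappedPattern.part hw) 0)
    simp only [pattern, longPattern, length_block, if_true, List.length_replicate] at this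
    omega
  rw [dict, Finset.sum_insert hnot, Finset.sum_image ((c.pattern_injective γ).injOn),
    length_longPattern]
  simp only [length_pattern, Finset.sum_const, Finset.card_univ, Fintype.card_fun,
    Fintype.card_prod, Fintype.card_fin, smul_eq_mul]
  omega

theorem exists_of_mem_gpiOutput {κ γ k D : ℕ} (hk : D ≤ k) {f : Fin N → Fin M}
    {P : GappedPattern A κ} (hP : P ∈ gpiOutput (c.dict κ γ k) (c.doc D f)) :
    ∃ w, P = c.pattern γ w ∧ ∀ i, f (w i).1 = (w i).2 := by
  classical
  obtain ⟨hP, hmatch⟩ := Finset.mem_filter.1 hP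
  rcases Finset.mem_insert.1 hP with rfl | hP
  · exact absurd hmatch (c.not_longPattern_matches (by rw [length_doc]; exact hk))
  · obtain ⟨w, -, rfl⟩ := Finset.mem_image.1 hP
    exact ⟨w, rfl, c.apply_eq_of_matches hmatch⟩

theorem pattern_mem_gpiOutput {κ γ k D : ℕ} {f : Fin N → Fin M} {w : Fin (κ + 1) → Fin N × Fin M}
    (h : (c.pattern γ w).Matches (c.doc D f)) :
    c.pattern γ w ∈ gpiOutput (c.dict κ γ k) (c.doc D f) := by
  classical
  exact Finset.mem_filter.2
    ⟨Finset.mem_insert_of_mem (Finset.mem_image_of_mem _ (Finset.mem_univ w)), h⟩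

/-! ### Number of outputs and of common outputs -/

/-- The position reached from `i` after `j` steps of lengths `d l + 1`. -/
def stepSum {κ s : ℕ} (i : ℕ) (d : Fin κ → Fin s) (j : ℕ) : ℕ :=
  i + ∑ l ∈ Finset.range j, if h : l < κ then (d ⟨l, h⟩ : ℕ) + 1 else 0

theorem stepSum_zero {κ s : ℕ} (i : ℕ) (d : Fin κ → Fin s) : stepSum i d 0 = i := by
  simp [stepSum]

theorem stepSum_succ {κ s : ℕ} (i : ℕ) (d : Fin κ → Fin s) (j : Fin κ) :
    stepSum i d (j + 1) = stepSum i d j + (d j + 1) := by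
  rw [stepSum, stepSum, Finset.sum_range_succ, dif_pos j.2, Fin.eta]
  omega

theorem stepSum_le {κ s : ℕ} (i : ℕ) (d : Fin κ → Fin s) {j : ℕ} (hj : j ≤ κ) :
    stepSum i d j ≤ i + κ * s := by
  have h1 : ∑ l ∈ Finset.range j, (if h : l < κ then (d ⟨l, h⟩ : ℕ) + 1 else 0) ≤
      ∑ _l ∈ Finset.range j, s := by
    refine Finset.sum_le_sum fun l _ => ?_
    split_ifs with h
    · exact (d ⟨l, h⟩).2
    · exact Nat.zero_le _
  simp only [Finset.sum_const, Finset.card_range, smul_eq_mul] at h1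
  have h2 := Nat.mul_le_mul_right s hj
  rw [stepSum]
  omega

/-- Choose a first block and `κ` steps of `1` to `s` blocks. A step of `d + 1` blocks leaves a gap
of `d * B ≤ γ` letters, and different choices give different patterns. -/
theorem le_card_gpiOutput {κ γ k D s : ℕ} (hD : N * B ≤ D) (hs : (s - 1) * B ≤ γ)
    (f : Fin N → Fin M) :
    (N - κ * s) * s ^ κ ≤ (gpiOutput (c.dict κ γ k) (c.doc D f)).card := by
  classical
  have hlt : ∀ (x : Fin (N - κ * s) × (Fin κ → Fin s)) (j : Fin (κ + 1)),
      stepSum x.1 x.2 j < N := fun x j => by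
    have h1 := stepSum_le x.1 x.2 (Nat.lt_succ_iff.1 j.2)
    have h2 := x.1.2
    omega
  let p : Fin (N - κ * s) × (Fin κ → Fin s) → Fin (κ + 1) → Fin N := fun x j =>
    ⟨stepSum x.1 x.2 j, hlt x j⟩
  let φ : Fin (N - κ * s) × (Fin κ → Fin s) → GappedPattern A κ := fun x =>
    c.pattern γ fun j => (p x j, f (p x j))
  have hφ : Function.Injective φ := by
    intro x y hxy
    have h1 : ∀ j : Fin (κ + 1), stepSum x.1 x.2 j = stepSum y.1 y.2 j := fun j =>
      congrArg (fun z : Fin N × Fin M => (z.1 : ℕ)) (congrFun (c.pattern_injective γ hxy) j)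
    refine Prod.ext (Fin.ext ?_) (funext fun j => Fin.ext ?_)
    · simpa [stepSum_zero] using h1 0
    · have h2 := h1 j.succ
      have h3 := h1 j.castSucc
      rw [Fin.val_succ, stepSum_succ, stepSum_succ] at h2
      rw [Fin.val_castSucc] at h3
      omega
  have hmem : ∀ x, φ x ∈ gpiOutput (c.dict κ γ k) (c.doc D f) := by
    intro x
    refine c.pattern_mem_gpiOutput (c.pattern_matches_doc hD f (p x) (fun i => ?_) fun i => ?_)
    · have := stepSum_succ x.1 x.2 i
      simp only [p, Fin.val_succ, Fin.val_castSucc]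
      omega
    · have h1 := stepSum_succ x.1 x.2 i
      have h2 : (x.2 i : ℕ) * B ≤ (s - 1) * B :=
        Nat.mul_le_mul_right _ (Nat.le_sub_one_of_lt (x.2 i).2)
      simp only [p, Fin.val_succ, Fin.val_castSucc]
      rw [h1, add_mul, add_mul]
      omega
  have := Finset.card_le_card_of_injOn φ (s := Finset.univ) (fun x _ => hmem x) hφ.injOn
  simpa using this

-- The pairs occurring in `Ps` form a set `S` with `|Ps| ≤ |S| ^ (κ + 1)`, so `|S| ≥ r`. All of them
-- lie on the graph of every admissible `f`, which leaves at most `N - r` free values.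
open Classical in
theorem card_filter_subset_gpiOutput_le {κ γ k D r : ℕ} (hk : D ≤ k) (hM : 1 ≤ M)
    {Ps : Finset (GappedPattern A κ)} (hPs : r ^ (κ + 1) ≤ Ps.card) :
    (Finset.univ.filter fun f : Fin N → Fin M =>
      Ps ⊆ gpiOutput (c.dict κ γ k) (c.doc D f)).card ≤ M ^ (N - r) := by
  rcases Finset.eq_empty_or_nonempty (Finset.univ.filter fun f : Fin N → Fin M =>
      Ps ⊆ gpiOutput (c.dict κ γ k) (c.doc D f)) with h | ⟨f₀, hf₀⟩
  · rw [h]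
    exact Nat.zero_le _
  have hf₀ := (Finset.mem_filter.1 hf₀).2
  let S : Finset (Fin N × Fin M) := Finset.univ.filter fun x =>
    ∃ w : Fin (κ + 1) → Fin N × Fin M, c.pattern γ w ∈ Ps ∧ ∃ i, w i = x
  have hS : ∀ f : Fin N → Fin M, Ps ⊆ gpiOutput (c.dict κ γ k) (c.doc D f) →
      ∀ x ∈ S, f x.1 = x.2 := by
    intro f hf x hx
    obtain ⟨w, hw, i, rfl⟩ := (Finset.mem_filter.1 hx).2
    obtain ⟨w', h1, h2⟩ := c.exists_of_mem_gpiOutput hk (hf hw)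
    rw [c.pattern_injective γ h1]
    exact h2 i
  have hrS : r ≤ S.card := by
    have hsub : Ps ⊆ (Fintype.piFinset fun _ : Fin (κ + 1) => S).image (c.pattern γ) := by
      intro P hP
      obtain ⟨w, rfl, -⟩ := c.exists_of_mem_gpiOutput hk (hf₀ hP)
      exact Finset.mem_image_of_mem _ (Fintype.mem_piFinset.2 fun i =>
        Finset.mem_filter.2 ⟨Finset.mem_univ _, w, hP, i, rfl⟩)
    have h1 := (Finset.card_le_card hsub).trans Finset.card_image_le
    rw [Fintype.card_piFinset_const] at h1
    exact (Nat.pow_le_pow_iff_left (Nat.succ_ne_zero κ)).1 (hPs.trans h1)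
  let I : Finset (Fin N) := S.image Prod.fst
  have hI : I.card = S.card := by
    refine Finset.card_image_of_injOn fun x hx y hy hxy => Prod.ext hxy ?_
    rw [← hS f₀ hf₀ x hx, ← hS f₀ hf₀ y hy, hxy]
  have hsub : (Finset.univ.filter fun f : Fin N → Fin M =>
      Ps ⊆ gpiOutput (c.dict κ γ k) (c.doc D f)) ⊆
      Fintype.piFinset fun i => if i ∈ I then {f₀ i} else Finset.univ := by
    intro f hf
    refine Fintype.mem_piFinset.2 fun i => ?_
    split_ifs with hi
    · obtain ⟨x, hx, rfl⟩ := Finset.mem_image.1 hi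
      rw [Finset.mem_singleton, hS f (Finset.mem_filter.1 hf).2 x hx, hS f₀ hf₀ x hx]
    · exact Finset.mem_univ _
  refine (Finset.card_le_card hsub).trans ?_
  rw [Fintype.card_piFinset]
  have hprod : ∀ i : Fin N, (if i ∈ I then ({f₀ i} : Finset (Fin M)) else Finset.univ).card =
      if i ∈ I then 1 else M := by
    intro i
    split_ifs <;> simp
  rw [Finset.prod_congr rfl fun i _ => hprod i, Finset.prod_ite, Finset.prod_const_one, one_mul,
    Finset.prod_const]
  have hcompl : (Finset.univ.filter fun i => i ∉ I).card = N - I.card := by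
    rw [← Finset.compl_filter, Finset.card_compl, Fintype.card_fin]
    simp
  rw [hcompl]
  exact Nat.pow_le_pow_right hM (by omega)

end MarkedCode

/-- The combinatorial form of the lower bound: a dictionary of total length `n` for which every
pointer structure has at least `M ^ r / 2 ^ O(K r ^ (κ + 1))` cells, provided that a query with
at least `(N - κ s) s ^ κ` outputs takes at most `K` steps for every output. -/
theorem exists_hard_dictionary {A : Type*} [Fintype A] (hA : 3 ≤ Fintype.card A)
    {κ γ D N M L s n r K : ℕ} (hM : 1 ≤ M) (hNM : N * M ≤ 2 ^ L) (hND : N * (L + 1) ≤ D)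
    (hLD : L + 1 ≤ D) (hn : (N * M) ^ (κ + 1) * ((κ + 1) * (L + 1)) + (D + 1 + κ) ≤ n)
    (hs : 1 ≤ s) (hsγ : (s - 1) * (L + 1) ≤ γ) (hr : 1 ≤ r)
    (hrN : 2 * r ^ (κ + 1) < N - κ * s) (hK : 1 ≤ K) :
    ∃ dict : Finset (GappedPattern A κ), (∀ P ∈ dict, P.IsStandard γ) ∧
      ∑ P ∈ dict, P.length = n ∧
      ∀ (G : PointerStructure (GappedPattern A κ)) (q C : ℝ),
        (∀ t : ℕ, (N - κ * s) * s ^ κ ≤ t → q + C * t ≤ K * t) →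
        G.AnswersGPI dict D q C →
        M ^ r ≤ G.size * 4 ^ (4 * K * r ^ (κ + 1) + 1) * 2 ^ (4 * K * r ^ (κ + 1)) := by
  classical
  obtain ⟨m, z, letter, h1, h2, h3, h4⟩ := exists_marked_code hA hNM
  let c : MarkedCode A N M (L + 1) := ⟨m, z, letter, h1, h2, h3, h4, Nat.succ_pos L⟩
  -- The slack `k` lengthens the long pattern, which makes the total exactly `n` and never matches a
  -- document of length `D`.
  obtain ⟨k, hk⟩ := Nat.exists_eq_add_of_le hn
  refine ⟨c.dict κ γ (D + k), fun P hP => c.isStandard_of_mem_dict hP, ?_, ?_⟩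
  · rw [c.sum_length_dict (by omega), hk]
    omega
  intro G q C hq hG
  have hrr : r ≤ r ^ (κ + 1) := Nat.le_self_pow (Nat.succ_ne_zero κ) r
  have hrN' : r ≤ N := by omega
  have key := G.card_le_size_mul
    (fun f : Fin N → Fin M => gpiOutput (c.dict κ γ (D + k)) (c.doc D f))
    (β := r ^ (κ + 1)) (k := 4 * K * r ^ (κ + 1)) (Q := M ^ (N - r)) ?_
    (fun Ps hPs => c.card_filter_subset_gpiOutput_le (Nat.le_add_right _ _) hM hPs)
  · rw [Fintype.card_fun, Fintype.card_fin, Fintype.card_fin] at key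
    have hpow : M ^ N = M ^ r * M ^ (N - r) := by rw [← pow_add]; congr 1; omega
    rw [hpow, ← mul_assoc] at key
    exact Nat.le_of_mul_le_mul_right key (Nat.pow_pos hM)
  · intro f
    have hcard := c.le_card_gpiOutput (κ := κ) (k := D + k) hND hsγ f
    obtain ⟨W, hW, hWO, hWcard⟩ := hG (c.doc D f) (c.length_doc D f)
    have hW2 := hWcard.trans (hq _ hcard)
    have hspos : 1 ≤ s ^ κ := Nat.one_le_pow _ _ hs
    have hout : N - κ * s ≤ (gpiOutput (c.dict κ γ (D + k)) (c.doc D f)).card :=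
      (Nat.le_mul_of_pos_right _ hspos).trans hcard
    obtain ⟨t, v, ht, htv⟩ := G.exists_dense_piece hW hWO hK (β := r ^ (κ + 1)) (by omega)
      (by exact_mod_cast hW2) (by omega)
    exact ⟨t, v, ht, htv.le⟩

/-! ### Choice of parameters and asymptotics -/

theorem exists_code_parameters {D : ℕ} {ε : ℝ} (hD : 1 ≤ D) (hε : ε ≤ 1)
    (h : 1 ≤ ε * Real.logb 2 D) :
    ∃ M L : ℕ, 1 ≤ M ∧ D * M ≤ 2 ^ L ∧ (M : ℝ) ≤ (D : ℝ) ^ ε ∧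
      ε * Real.logb 2 D - 1 ≤ Real.logb 2 M ∧ (L : ℝ) + 1 ≤ 2 + 2 * Real.logb 2 D := by
  have hD0 : (0 : ℝ) < D := by exact_mod_cast hD
  have hlog : 0 ≤ Real.logb 2 D := Real.logb_nonneg (by norm_num) (by exact_mod_cast hD)
  have hDε : (D : ℝ) ^ ε = 2 ^ (ε * Real.logb 2 D) := by
    rw [mul_comm, Real.rpow_mul (by norm_num), Real.rpow_logb (by norm_num) (by norm_num) hD0]
  have h2 : (2 : ℝ) ≤ (D : ℝ) ^ ε := by
    rw [hDε]
    calc (2 : ℝ) = 2 ^ (1 : ℝ) := by norm_num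
      _ ≤ _ := Real.rpow_le_rpow_of_exponent_le (by norm_num) h
  have hM : 1 ≤ ⌊(D : ℝ) ^ ε⌋₊ := Nat.le_floor (by push_cast; linarith)
  have hMle : (⌊(D : ℝ) ^ ε⌋₊ : ℝ) ≤ (D : ℝ) ^ ε := Nat.floor_le (by positivity)
  have hM0 : (0 : ℝ) < ⌊(D : ℝ) ^ ε⌋₊ := by exact_mod_cast hM
  refine ⟨⌊(D : ℝ) ^ ε⌋₊, Nat.clog 2 (D * ⌊(D : ℝ) ^ ε⌋₊), hM,
    Nat.le_pow_clog (by norm_num) _, hMle, ?_, ?_⟩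
  · rw [Real.le_logb_iff_rpow_le (by norm_num) hM0, Real.rpow_sub (by norm_num), ← hDε,
      Real.rpow_one]
    have := Nat.lt_floor_add_one ((D : ℝ) ^ ε)
    linarith
  · have hDM : (D * ⌊(D : ℝ) ^ ε⌋₊ : ℕ) ≠ 0 := by positivity
    have hDM1 : (1 : ℝ) ≤ (D * ⌊(D : ℝ) ^ ε⌋₊ : ℕ) := by
      exact_mod_cast Nat.one_le_iff_ne_zero.2 hDM
    have h3 : ((Nat.clog 2 (D * ⌊(D : ℝ) ^ ε⌋₊) : ℕ) : ℝ) ≤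
        Real.logb 2 ((D * ⌊(D : ℝ) ^ ε⌋₊ : ℕ) : ℝ) + 1 := by
      have h4 := Real.ceil_logb_natCast (b := 2) (r := ((D * ⌊(D : ℝ) ^ ε⌋₊ : ℕ) : ℝ))
        (by positivity)
      have h5 := Int.ceil_lt_add_one (Real.logb 2 ((D * ⌊(D : ℝ) ^ ε⌋₊ : ℕ) : ℝ))
      have h6 : Real.logb ((2 : ℕ) : ℝ) ((D * ⌊(D : ℝ) ^ ε⌋₊ : ℕ) : ℝ) =
        Real.logb 2 ((D * ⌊(D : ℝ) ^ ε⌋₊ : ℕ) : ℝ) := by norm_num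
      rw [h6, Int.clog_natCast] at h4
      rw [h4] at h5
      exact_mod_cast h5.le
    have h7 : Real.logb 2 ((D * ⌊(D : ℝ) ^ ε⌋₊ : ℕ) : ℝ) ≤ 2 * Real.logb 2 D := by
      push_cast
      rw [Real.logb_mul hD0.ne' hM0.ne']
      have h8 : Real.logb 2 (⌊(D : ℝ) ^ ε⌋₊ : ℝ) ≤ Real.logb 2 D := by
        refine Real.logb_le_logb_of_le (by norm_num) hM0 (hMle.trans ?_)
        calc (D : ℝ) ^ ε ≤ (D : ℝ) ^ (1 : ℝ) :=
              Real.rpow_le_rpow_of_exponent_le (by exact_mod_cast hD) hε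
          _ = D := Real.rpow_one _
      linarith
    linarith

/-- One factor `N` absorbs the block length, as `N * (L + 1) ≤ D`. Then `(D * M) ^ (κ + 1)` is at
most `n ^ ((1 + ε) * b)`, and the remaining power of `n` pays for `κ + 1` and the padding. -/
theorem total_length_le {n D N M L κ : ℕ} {b ε x : ℝ} (hn : 1 ≤ n) (hD : 1 ≤ D)
    (hND : N * (L + 1) ≤ D) (hb : 0 ≤ b) (hε : 0 ≤ ε) (hM : (M : ℝ) ≤ (D : ℝ) ^ ε)
    (hDn : (D : ℝ) ^ (κ + 1) ≤ (n : ℝ) ^ b) (hκ : (κ : ℝ) + 1 ≤ x)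
    (hx : 3 * x ≤ (n : ℝ) ^ (1 - (1 + ε) * b)) :
    (N * M) ^ (κ + 1) * ((κ + 1) * (L + 1)) + (D + 1 + κ) ≤ n := by
  have hn0 : (0 : ℝ) < n := by exact_mod_cast hn
  have hn1 : (1 : ℝ) ≤ n := by exact_mod_cast hn
  have hD1 : (1 : ℝ) ≤ D := by exact_mod_cast hD
  have hND' : N ≤ D := (Nat.le_mul_of_pos_right N (Nat.succ_pos L)).trans hND
  have h1 : (N * M) ^ (κ + 1) * ((κ + 1) * (L + 1)) ≤ (D * M) ^ (κ + 1) * (κ + 1) := by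
    calc (N * M) ^ (κ + 1) * ((κ + 1) * (L + 1))
        = N ^ κ * (N * (L + 1)) * M ^ (κ + 1) * (κ + 1) := by ring
      _ ≤ D ^ κ * D * M ^ (κ + 1) * (κ + 1) := by gcongr
      _ = (D * M) ^ (κ + 1) * (κ + 1) := by ring
  have h2 : ((D : ℝ) * M) ^ (κ + 1) ≤ (n : ℝ) ^ ((1 + ε) * b) := by
    calc ((D : ℝ) * M) ^ (κ + 1) ≤ ((D : ℝ) * (D : ℝ) ^ ε) ^ (κ + 1) := by gcongr
      _ = ((D : ℝ) ^ (κ + 1)) ^ (1 + ε) := by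
        rw [← Real.rpow_natCast, ← Real.rpow_natCast, ← Real.rpow_mul (by positivity),
          ← Real.rpow_one_add' (by positivity) (by positivity),
          ← Real.rpow_mul (by positivity), mul_comm]
      _ ≤ ((n : ℝ) ^ b) ^ (1 + ε) := by gcongr
      _ = (n : ℝ) ^ ((1 + ε) * b) := by rw [← Real.rpow_mul hn0.le, mul_comm]
  have h3 : (D : ℝ) ≤ (n : ℝ) ^ ((1 + ε) * b) := by
    calc (D : ℝ) ≤ (D : ℝ) ^ (κ + 1) := le_self_pow₀ hD1 (Nat.succ_ne_zero κ)
      _ ≤ (n : ℝ) ^ b := hDn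
      _ ≤ _ := Real.rpow_le_rpow_of_exponent_le hn1 (by nlinarith)
  have h4 : (1 : ℝ) ≤ (n : ℝ) ^ ((1 + ε) * b) := Real.one_le_rpow hn1 (by positivity)
  have h5 : (n : ℝ) = (n : ℝ) ^ (1 - (1 + ε) * b) * (n : ℝ) ^ ((1 + ε) * b) := by
    rw [← Real.rpow_add hn0, sub_add_cancel, Real.rpow_one]
  have hx1 : 1 ≤ x := by
    have : (0 : ℝ) ≤ κ := Nat.cast_nonneg κ
    linarith
  have h6 : ((D : ℝ) * M) ^ (κ + 1) * (κ + 1) + (D + 1 + κ) ≤ n := by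
    set y := (n : ℝ) ^ ((1 + ε) * b)
    calc ((D : ℝ) * M) ^ (κ + 1) * (κ + 1) + (D + 1 + κ) ≤ y * x + (x * y + x * y) := by
          have e1 : ((D : ℝ) * M) ^ (κ + 1) * (κ + 1) ≤ y * x := by gcongr
          have e2 : (D : ℝ) ≤ x * y := by nlinarith
          have e3 : (1 : ℝ) + κ ≤ x * y := by nlinarith
          linarith
      _ = 3 * x * y := by ring
      _ ≤ _ := by rw [h5]; gcongr
  refine (Nat.add_le_add_right h1 _).trans ?_
  exact_mod_cast h6

/-- Of `D / B`, the gaps use at most half, and rounding costs at most `κ + 1`, a quarter. -/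
theorem le_natCast_sub {D κ γ B : ℕ} (hB : 1 ≤ B) (hγ : 2 * κ * γ ≤ D)
    (hD : 4 * ((κ : ℝ) + 1) * B ≤ D) :
    (D : ℝ) / (4 * B) ≤ ((D / B - κ * (γ / B + 1) : ℕ) : ℝ) := by
  have hB0 : (0 : ℝ) < B := by exact_mod_cast hB
  have h1 : (D : ℝ) / B - 1 ≤ ((D / B : ℕ) : ℝ) := by
    have := Nat.lt_floor_add_one ((D : ℝ) / B)
    rw [Nat.floor_div_eq_div] at this
    linarith
  have h2 : ((γ / B : ℕ) : ℝ) ≤ (γ : ℝ) / B := Nat.cast_div_le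
  have h3 : (κ : ℝ) * ((γ : ℝ) / B) ≤ (D : ℝ) / B / 2 := by
    have : (2 : ℝ) * κ * γ ≤ D := by exact_mod_cast hγ
    calc (κ : ℝ) * ((γ : ℝ) / B) = (2 * κ * γ) / B / 2 := by ring
      _ ≤ _ := by gcongr
  have h4 : (κ : ℝ) + 1 ≤ (D : ℝ) / B / 4 := by
    rw [div_div, le_div_iff₀ (by positivity)]
    linarith
  have h5 : (D : ℝ) / (4 * B) = (D : ℝ) / B / 4 := by rw [div_div, mul_comm]
  have h6 : ((D / B : ℕ) : ℝ) - ((κ * (γ / B + 1) : ℕ) : ℝ) ≤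
      ((D / B - κ * (γ / B + 1) : ℕ) : ℝ) := by
    rw [sub_le_iff_le_add]
    exact_mod_cast le_tsub_add
  have h7 : ((κ * (γ / B + 1) : ℕ) : ℝ) ≤ (D : ℝ) / B / 2 + κ := by
    push_cast
    nlinarith [Nat.cast_nonneg (α := ℝ) κ]
  rw [h5]
  linarith

/-- After taking logarithms, `hK` lets half of the main term `r * ε * a * Λ / x` pay for all losses.
Of `x ^ 2 ≤ Λ ^ (1 / (4κ))`, one factor `x` cancels the denominator and the other beats the
constants through `hεa`. -/
theorem rpow_le_of_pow_le {n M r κ K : ℕ} {S : ℕ} {a ε x l : ℝ} (hn : 1 ≤ n)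
    (hM : 1 ≤ M) (hκ : 1 ≤ κ)
    (hΛ : 1 ≤ Real.logb 2 n) (hr : r = ⌊(Real.logb 2 n) ^ (3 / (4 * (κ : ℝ)))⌋₊)
    (hx : 0 < x) (hlogM : ε * l - 1 ≤ Real.logb 2 M)
    (hε : 0 ≤ ε) (hl : a * Real.logb 2 n / x ≤ l)
    (hx2 : x ^ 2 ≤ (Real.logb 2 n) ^ (1 / (4 * (κ : ℝ))))
    (hK : 3 + 12 * K * (Real.logb 2 n) ^ (3 / 4 : ℝ) ≤ ε * (a * Real.logb 2 n / x) / 2)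
    (hεa : 4 ≤ ε * a * x)
    (h : M ^ r ≤ S * 4 ^ (4 * K * r ^ (κ + 1) + 1) * 2 ^ (4 * K * r ^ (κ + 1))) :
    (n : ℝ) ^ (1 * (Real.logb 2 n) ^ (1 / (2 * (κ : ℝ)))) ≤ S := by
  have hn0 : (0 : ℝ) < n := by exact_mod_cast hn
  have hM0 : (0 : ℝ) < M := by exact_mod_cast hM
  have hκ0 : (0 : ℝ) < κ := by exact_mod_cast hκ
  set Λ := Real.logb 2 n with hΛdef
  have hΛ0 : 0 < Λ := by linarith
  set y := Λ ^ (3 / (4 * (κ : ℝ))) with hy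
  have hy1 : 1 ≤ y := Real.one_le_rpow hΛ (by positivity)
  have hr1 : 1 ≤ r := by rw [hr]; exact Nat.le_floor (by exact_mod_cast hy1)
  have hr1' : (1 : ℝ) ≤ r := by exact_mod_cast hr1
  have hry : (r : ℝ) ≤ y := by rw [hr]; exact Nat.floor_le (by linarith)
  have hyr : y / 2 ≤ r := by
    have := Nat.lt_floor_add_one y
    rw [← hr] at this
    linarith
  have hrκ : (r : ℝ) ^ κ ≤ Λ ^ (3 / 4 : ℝ) := by
    calc (r : ℝ) ^ κ ≤ y ^ κ := by gcongr
      _ = Λ ^ (3 / 4 : ℝ) := by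
        rw [hy, ← Real.rpow_natCast, ← Real.rpow_mul hΛ0.le]
        congr 1
        field_simp
  have hS : 1 ≤ S := by
    rcases Nat.eq_zero_or_pos S with h0 | h0
    · rw [h0] at h
      have := Nat.pow_pos (n := r) hM
      simp at h
      omega
    · exact h0
  have hS0 : (0 : ℝ) < S := by exact_mod_cast hS
  have hreal : (M : ℝ) ^ r ≤ S * 2 ^ (12 * K * r ^ (κ + 1) + 2) := by
    calc (M : ℝ) ^ r ≤ S * 4 ^ (4 * K * r ^ (κ + 1) + 1) * 2 ^ (4 * K * r ^ (κ + 1)) := by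
          exact_mod_cast h
      _ = S * 2 ^ (12 * K * r ^ (κ + 1) + 2) := by
          rw [show (4 : ℝ) = 2 ^ 2 by norm_num, ← pow_mul, mul_assoc, ← pow_add]
          congr 2
          ring
  have hlog := Real.logb_le_logb_of_le (b := 2) (by norm_num) (by positivity) hreal
  rw [Real.logb_pow, Real.logb_mul hS0.ne' (by positivity), Real.logb_pow,
    Real.logb_self_eq_one (by norm_num)] at hlog
  push_cast at hlog
  have h1 : (12 * K * (r : ℝ) ^ (κ + 1) + 2) ≤ r * (12 * K * Λ ^ (3 / 4 : ℝ) + 2) := by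
    have : (12 * K * (r : ℝ) ^ (κ + 1)) ≤ r * (12 * K * Λ ^ (3 / 4 : ℝ)) := by
      calc (12 * K * (r : ℝ) ^ (κ + 1)) = r * (12 * K * (r : ℝ) ^ κ) := by ring
        _ ≤ _ := by gcongr
    linarith
  have h2 : (r : ℝ) * (ε * (a * Λ / x) / 2) ≤ Real.logb 2 S := by
    have e1 : (r : ℝ) * (ε * l - 1) ≤ r * Real.logb 2 M := by gcongr
    have e2 : (r : ℝ) * (ε * (a * Λ / x)) ≤ r * (ε * l) := by gcongr
    have e3 : (r : ℝ) * (3 + 12 * K * Λ ^ (3 / 4 : ℝ)) ≤ r * (ε * (a * Λ / x) / 2) := by gcongr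
    linarith
  have h3 : Λ * Λ ^ (1 / (2 * (κ : ℝ))) ≤ (r : ℝ) * (ε * (a * Λ / x) / 2) := by
    have hysplit : y = Λ ^ (1 / (2 * (κ : ℝ))) * Λ ^ (1 / (4 * (κ : ℝ))) := by
      rw [hy, ← Real.rpow_add hΛ0]
      congr 1
      field_simp
      norm_num
    set u := Λ ^ (1 / (2 * (κ : ℝ))) with hu
    have hu0 : 0 < u := Real.rpow_pos_of_pos hΛ0 _
    have hεa0 : 0 ≤ ε * a := by
      by_contra hneg
      push Not at hneg
      nlinarith
    have e0 : ε * (a * Λ / x) / 2 = (ε * a) * Λ / (2 * x) := by field_simp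
    calc Λ * u = 4 * (Λ * u) / 4 := by ring
      _ ≤ (ε * a * x) * (Λ * u) / 4 := by gcongr
      _ = (u * x ^ 2 / 2) * ((ε * a) * Λ / (2 * x)) := by field_simp; norm_num
      _ ≤ (y / 2) * ((ε * a) * Λ / (2 * x)) := by rw [hysplit]; gcongr
      _ ≤ r * ((ε * a) * Λ / (2 * x)) := by gcongr
      _ = _ := by rw [e0]
  have h4 : (n : ℝ) = 2 ^ Λ := (Real.rpow_logb (by norm_num) (by norm_num) hn0).symm
  calc (n : ℝ) ^ (1 * Λ ^ (1 / (2 * (κ : ℝ)))) = 2 ^ (Λ * Λ ^ (1 / (2 * (κ : ℝ)))) := by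
        rw [one_mul, Real.rpow_mul (by norm_num), ← h4]
    _ ≤ 2 ^ Real.logb 2 (S : ℝ) :=
        Real.rpow_le_rpow_of_exponent_le (by norm_num) (h3.trans h2)
    _ = S := Real.rpow_logb (by norm_num) (by norm_num) hS0

theorem exists_dict_of_bounds {A : Type*} [Fintype A] (hA : 3 ≤ Fintype.card A)
    {n D κ γ K : ℕ} {a b ε q C x : ℝ} (hn : 1 ≤ n) (hD : 1 ≤ D) (hκ : 1 ≤ κ)
    (hKC : 1 + |C| ≤ K) (hε0 : 0 ≤ ε) (hε1 : ε ≤ 1) (hb : 0 ≤ b)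
    (hΛ : 1 ≤ Real.logb 2 n) (hκx : (κ : ℝ) + 1 ≤ x) (hxΛ : x ≤ Real.logb 2 n)
    (hDn : (D : ℝ) ^ (κ + 1) ≤ (n : ℝ) ^ b) (hxn : 3 * x ≤ (n : ℝ) ^ (1 - (1 + ε) * b))
    (hγ : 2 * κ * γ ≤ D) (hDΛ : 8 * (2 + 2 * Real.logb 2 D) * (Real.logb 2 n) ^ 2 < D)
    (hl : a * Real.logb 2 n / x ≤ Real.logb 2 D)
    (hx2 : x ^ 2 ≤ (Real.logb 2 n) ^ (1 / (4 * (κ : ℝ))))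
    (hK : 3 + 12 * K * (Real.logb 2 n) ^ (3 / 4 : ℝ) ≤ ε * (a * Real.logb 2 n / x) / 2)
    (hεa : 4 ≤ ε * a * x)
    (hq : q ≤ 1 / 4 * ((D : ℝ) * (γ : ℝ) ^ κ / (2 + 2 * Real.logb 2 D) ^ (κ + 1))) :
    ∃ dict : Finset (GappedPattern A κ), (∀ P ∈ dict, P.IsStandard γ) ∧
      ∑ P ∈ dict, P.length = n ∧
      ∀ G : PointerStructure (GappedPattern A κ), G.AnswersGPI dict D q C →
        (n : ℝ) ^ (1 * (Real.logb 2 n) ^ (1 / (2 * (κ : ℝ)))) ≤ (G.size : ℝ) := by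
  set Λ := Real.logb 2 n with hΛdef
  have hΛ0 : 0 < Λ := by linarith
  have hκ0 : (1 : ℝ) ≤ κ := by exact_mod_cast hκ
  have hx0 : 0 < x := by linarith
  have hlogD : 0 ≤ Real.logb 2 D := Real.logb_nonneg (by norm_num) (by exact_mod_cast hD)
  have hεl : 1 ≤ ε * Real.logb 2 D := by
    have h1 : ε * (a * Λ / x) ≤ ε * Real.logb 2 D := by gcongr
    have h2 : 0 ≤ 12 * K * Λ ^ (3 / 4 : ℝ) := by positivity
    linarith
  obtain ⟨M, L, hM, hDM, hMD, hlogM, hL⟩ := exists_code_parameters hD hε1 hεl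
  obtain ⟨r, hr⟩ : ∃ r : ℕ, r = ⌊Λ ^ (3 / (4 * (κ : ℝ)))⌋₊ := ⟨_, rfl⟩
  have hND : D / (L + 1) * (L + 1) ≤ D := Nat.div_mul_le_self D (L + 1)
  have hB0 : (0 : ℝ) < ((L + 1 : ℕ) : ℝ) := by positivity
  have hL' : ((L + 1 : ℕ) : ℝ) ≤ 2 + 2 * Real.logb 2 D := by exact_mod_cast hL
  have hΛ2 : Λ ≤ Λ ^ 2 := by nlinarith
  have hDκ : 4 * ((κ : ℝ) + 1) * ((L + 1 : ℕ) : ℝ) ≤ D := by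
    calc 4 * ((κ : ℝ) + 1) * ((L + 1 : ℕ) : ℝ) ≤ 4 * Λ ^ 2 * (2 + 2 * Real.logb 2 D) := by
          gcongr
          linarith
      _ ≤ 8 * (2 + 2 * Real.logb 2 D) * Λ ^ 2 := by
          have : 0 ≤ (2 + 2 * Real.logb 2 D) * Λ ^ 2 := by positivity
          linarith
      _ ≤ D := hDΛ.le
  have hsub := le_natCast_sub (Nat.succ_pos L) hγ hDκ
  have hr1 : 1 ≤ r := by
    rw [hr]
    exact Nat.le_floor (by exact_mod_cast Real.one_le_rpow hΛ (by positivity))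
  have hrΛ : (r : ℝ) ^ (κ + 1) ≤ Λ ^ 2 := by
    calc (r : ℝ) ^ (κ + 1) ≤ (Λ ^ (3 / (4 * (κ : ℝ)))) ^ (κ + 1) := by
          gcongr
          rw [hr]
          exact Nat.floor_le (by positivity)
      _ = Λ ^ (3 / (4 * (κ : ℝ)) * ((κ + 1 : ℕ) : ℝ)) := by
          rw [← Real.rpow_natCast, ← Real.rpow_mul hΛ0.le]
      _ ≤ Λ ^ (2 : ℝ) := by
          refine Real.rpow_le_rpow_of_exponent_le hΛ ?_
          push_cast
          rw [div_mul_eq_mul_div, div_le_iff₀ (by positivity)]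
          linarith
      _ = Λ ^ 2 := by norm_num
  have hrN : 2 * r ^ (κ + 1) < D / (L + 1) - κ * (γ / (L + 1) + 1) := by
    have h1 : (2 * (r : ℝ) ^ (κ + 1)) < D / (4 * ((L + 1 : ℕ) : ℝ)) := by
      rw [lt_div_iff₀ (by positivity)]
      calc 2 * (r : ℝ) ^ (κ + 1) * (4 * ((L + 1 : ℕ) : ℝ))
          ≤ 2 * Λ ^ 2 * (4 * (2 + 2 * Real.logb 2 D)) := by gcongr
        _ = 8 * (2 + 2 * Real.logb 2 D) * Λ ^ 2 := by ring
        _ < D := hDΛ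
    exact_mod_cast h1.trans_le hsub
  have hK1 : 1 ≤ K := by
    have : (1 : ℝ) ≤ K := by linarith [abs_nonneg C]
    exact_mod_cast this
  have hLD : L + 1 ≤ D := by
    have : ((L + 1 : ℕ) : ℝ) ≤ D := by nlinarith
    exact_mod_cast this
  obtain ⟨dict, h1, h2, h3⟩ := exists_hard_dictionary (γ := γ) hA hM
    ((Nat.mul_le_mul_right M (Nat.div_le_self D (L + 1))).trans hDM) hND hLD
    (total_length_le hn hD hND hb hε0 hMD hDn hκx hxn) (Nat.le_add_left 1 (γ / (L + 1)))
    ((Nat.mul_le_mul_right _ (Nat.add_sub_cancel ..).le).trans (Nat.div_mul_le_self γ (L + 1))) hr1 hrN hK1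
  refine ⟨dict, h1, h2, fun G hG => ?_⟩
  refine rpow_le_of_pow_le hn hM hκ hΛ hr hx0 hlogM hε0 hl hx2 hK hεa (h3 G q C ?_ hG)
  intro t ht
  -- This bound on the output size gives `q ≤ t`, so `K ≥ 1 + |C|` suffices.
  have ht' : (D : ℝ) / (4 * ((L + 1 : ℕ) : ℝ)) * ((γ : ℝ) / ((L + 1 : ℕ) : ℝ)) ^ κ ≤ t := by
    refine le_trans ?_ (Nat.cast_le.2 ht)
    rw [Nat.cast_mul, Nat.cast_pow]
    have hs : (γ : ℝ) / ((L + 1 : ℕ) : ℝ) ≤ ((γ / (L + 1) + 1 : ℕ) : ℝ) := by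
      have := Nat.lt_floor_add_one ((γ : ℝ) / ((L + 1 : ℕ) : ℝ))
      rw [Nat.floor_div_eq_div] at this
      exact_mod_cast this.le
    gcongr
  have hqt : q ≤ t := by
    refine hq.trans (le_trans ?_ ht')
    have e : (D : ℝ) / (4 * ((L + 1 : ℕ) : ℝ)) * ((γ : ℝ) / ((L + 1 : ℕ) : ℝ)) ^ κ =
        1 / 4 * ((D : ℝ) * (γ : ℝ) ^ κ / ((L + 1 : ℕ) : ℝ) ^ (κ + 1)) := by
      rw [div_pow, pow_succ]
      field_simp
    rw [e]
    gcongr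
  have hC : C * t ≤ |C| * t := by
    gcongr
    exact le_abs_self C
  have : (1 + |C|) * (t : ℝ) ≤ K * t := by gcongr
  linarith

theorem mainTheorem3 :
    ∃ c : ℝ, 0 < c ∧
      ∀ (A : Type) [Fintype A], 3 ≤ Fintype.card A →
      ∀ (κ γ D : ℕ → ℕ) (q : ℕ → ℝ) (a b C : ℝ),
        0 < a → b < 1 →
        (∀ᶠ n in atTop, 1 ≤ κ n) →
        (fun n => (κ n : ℝ)) =o[atTop]
          (fun n : ℕ => Real.logb 2 (Real.logb 2 n) /
            Real.logb 2 (Real.logb 2 (Real.logb 2 n))) →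
        (∀ᶠ n : ℕ in atTop, (n : ℝ) ^ (a / ((κ n : ℝ) + 1)) ≤ (D n : ℝ) ∧
          (D n : ℝ) ≤ (n : ℝ) ^ (b / ((κ n : ℝ) + 1))) →
        (∀ᶠ n in atTop, 1 ≤ γ n ∧ 2 * κ n * γ n ≤ D n) →
        q =o[atTop]
          (fun n => (D n : ℝ) * (γ n : ℝ) ^ κ n / (2 + 2 * Real.logb 2 (D n)) ^ (κ n + 1)) →
        ∀ᶠ n : ℕ in atTop,
          ∃ dict : Finset (GappedPattern A (κ n)),
            (∀ P ∈ dict, P.IsStandard (γ n)) ∧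
            ∑ P ∈ dict, P.length = n ∧
            ∀ G : PointerStructure (GappedPattern A (κ n)),
              G.AnswersGPI dict (D n) (q n) C →
                (n : ℝ) ^ (c * (Real.logb 2 n) ^ (1 / (2 * (κ n : ℝ)))) ≤ (G.size : ℝ) := by
  refine ⟨1, one_pos, ?_⟩
  intro A _ hA κ γ D q a b C ha hb hκ1 hκ hD hγ hq
  -- The sign of `b` is not given, but the length estimate needs a nonnegative exponent.
  obtain ⟨b', hbb', hb0, hb1⟩ : ∃ b' : ℝ, b ≤ b' ∧ 0 ≤ b' ∧ b' < 1 :=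
    ⟨max b 0, le_max_left _ _, le_max_right _ _, max_lt hb one_pos⟩
  obtain ⟨ε, hε0, hε1, hδ⟩ : ∃ ε : ℝ, 0 < ε ∧ ε ≤ 1 ∧ 0 < 1 - (1 + ε) * b' :=
    ⟨(1 - b') / 2, by linarith, by linarith, by nlinarith⟩
  obtain ⟨K, hK⟩ := exists_nat_ge (1 + |C|)
  have hlog2 : Tendsto (Real.logb 2) atTop atTop := Real.tendsto_logb_atTop (by norm_num)
  have hΛ : Tendsto (fun n : ℕ => Real.logb 2 n) atTop atTop :=
    hlog2.comp tendsto_natCast_atTop_atTop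
  have hμ := hlog2.comp hΛ
  have hν := hlog2.comp hμ
  have hmulog : ∀ e : ℝ, 0 < e → ∀ c : ℝ, 0 < c → ∀ᶠ Λ : ℝ in atTop,
      Real.logb 2 Λ ≤ c * Λ ^ e := by
    intro e he c hc
    have h1 : (Real.logb 2) =o[atTop] fun Λ : ℝ => Λ ^ e := by
      have := (isLittleO_log_rpow_atTop he).const_mul_left (Real.log 2)⁻¹
      refine this.congr_left fun x => ?_
      rw [Real.logb, div_eq_inv_mul]
    filter_upwards [h1.bound hc, eventually_ge_atTop 0] with Λ h hΛ
    have := (le_abs_self _).trans h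
    rwa [Real.norm_of_nonneg (Real.rpow_nonneg hΛ e)] at this
  have hlam : ∀ᶠ l : ℝ in atTop, 8 * (2 + 2 * l) * (l ^ 2) ^ 2 < 2 ^ l := by
    have h5 := (isLittleO_rpow_exp_pos_mul_atTop 5 (Real.log_pos one_lt_two)).bound
      (show (0 : ℝ) < 1 / 64 by norm_num)
    filter_upwards [h5, eventually_ge_atTop 1] with l h hl
    have hpow : l ^ (5 : ℝ) = l ^ 5 := by norm_cast
    rw [hpow, Real.norm_of_nonneg (by positivity), Real.norm_of_nonneg (by positivity),
      ← Real.rpow_def_of_pos two_pos] at h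
    have h0 : (0 : ℝ) < 2 ^ l := Real.rpow_pos_of_pos two_pos l
    calc 8 * (2 + 2 * l) * (l ^ 2) ^ 2 ≤ 8 * (2 * l + 2 * l) * (l ^ 2) ^ 2 := by gcongr; linarith
      _ = 32 * l ^ 5 := by ring
      _ < 2 ^ l := by linarith
  have hKΛ : ∀ᶠ Λ : ℝ in atTop, 3 + 12 * K * Λ ^ (3 / 4 : ℝ) ≤
      ε * (a * Λ / Real.logb 2 Λ) / 2 := by
    have hc : 0 < ε * a / (2 * (3 + 12 * K)) := by positivity
    filter_upwards [hmulog (1 / 4) (by norm_num) _ hc, hlog2.eventually_gt_atTop 0,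
      eventually_ge_atTop 1] with Λ h hμ hΛ
    have hΛ0 : 0 < Λ := by linarith
    have h1 : 1 ≤ Λ ^ (3 / 4 : ℝ) := Real.one_le_rpow hΛ (by norm_num)
    have hsplit : Λ = Λ ^ (3 / 4 : ℝ) * Λ ^ (1 / 4 : ℝ) := by
      rw [← Real.rpow_add hΛ0]; norm_num
    calc 3 + 12 * K * Λ ^ (3 / 4 : ℝ) ≤ (3 + 12 * K) * Λ ^ (3 / 4 : ℝ) := by linarith
      _ ≤ ε * a * Λ / (2 * Real.logb 2 Λ) := by
        rw [le_div_iff₀ (by positivity)]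
        calc (3 + 12 * K) * Λ ^ (3 / 4 : ℝ) * (2 * Real.logb 2 Λ)
            ≤ (3 + 12 * K) * Λ ^ (3 / 4 : ℝ) *
              (2 * (ε * a / (2 * (3 + 12 * K)) * Λ ^ (1 / 4 : ℝ))) := by gcongr
          _ = ε * a * (Λ ^ (3 / 4 : ℝ) * Λ ^ (1 / 4 : ℝ)) := by field_simp
          _ = ε * a * Λ := by rw [← hsplit]
      _ = ε * (a * Λ / Real.logb 2 Λ) / 2 := by field_simp
  have hlt : Tendsto (fun Λ : ℝ => Λ ^ (1 / 2 : ℝ)) atTop atTop :=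
    tendsto_rpow_atTop (by norm_num)
  obtain ⟨l₀, hl₀⟩ := eventually_atTop.1 hlam
  -- The constant `1 / 8` gives `2 * ν ≤ μ / (4κ)`, that is `μ ^ 2 ≤ Λ ^ (1 / (4κ))`; the `1 / 4`
  -- for `q` matches the factor in the lower bound for the output.
  filter_upwards [hκ1, hκ.bound (show (0 : ℝ) < 1 / 8 by norm_num), hD, hγ,
    hq.bound (show (0 : ℝ) < 1 / 4 by norm_num), eventually_ge_atTop 1,
    hΛ.eventually_ge_atTop 1, hμ.eventually_ge_atTop (4 / (ε * a)),
    hμ.eventually_ge_atTop 2, hν.eventually_ge_atTop 1,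
    hΛ.eventually (hmulog 1 one_pos 1 one_pos),
    hΛ.eventually (hmulog (1 / 2) (by norm_num) a ha),
    hΛ.eventually (hlt.eventually_ge_atTop (max l₀ 0)),
    hΛ.eventually hKΛ,
    tendsto_natCast_atTop_atTop.eventually (hmulog (1 - (1 + ε) * b') hδ (1 / 3) (by norm_num))]
    with n hκ1 hκ hD hγ hq hn hΛ1 hμa hμ2 hν1 hμΛ hμa' hΛl hKΛ hΛn
  simp only [Function.comp_apply] at hμa hμ2 hν1
  have hn1 : (1 : ℝ) ≤ n := by exact_mod_cast hn
  have hn0 : (0 : ℝ) < n := by linarith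
  have hκ0 : (1 : ℝ) ≤ κ n := by exact_mod_cast hκ1
  set Λ := Real.logb 2 n with hΛdef
  set μ := Real.logb 2 Λ with hμdef
  set ν := Real.logb 2 μ with hνdef
  have hκμν : (κ n : ℝ) * (8 * ν) ≤ μ := by
    rw [Real.norm_of_nonneg (by linarith), Real.norm_of_nonneg (by positivity)] at hκ
    have : (1 : ℝ) / 8 * (μ / ν) = μ / (8 * ν) := by field_simp
    rwa [this, le_div_iff₀ (by positivity)] at hκ
  have hκμ : (κ n : ℝ) + 1 ≤ μ := by nlinarith
  have hΛ0 : 0 < Λ := one_pos.trans_le hΛ1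
  rw [Real.rpow_one, one_mul] at hμΛ
  have hD1 : (1 : ℝ) ≤ D n := (Real.one_le_rpow hn1 (by positivity)).trans hD.1
  have hl : a * Λ / μ ≤ Real.logb 2 (D n) := by
    have h1 := Real.logb_le_logb_of_le (b := 2) (by norm_num) (by positivity) hD.1
    rw [Real.logb_rpow_eq_mul_logb_of_pos hn0] at h1
    refine le_trans ?_ h1
    rw [← hΛdef, div_mul_eq_mul_div]
    gcongr
  have hΛsqrt : Λ ^ (1 / 2 : ℝ) ≤ Real.logb 2 (D n) := by
    refine le_trans ?_ hl
    rw [le_div_iff₀ (by linarith)]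
    calc Λ ^ (1 / 2 : ℝ) * μ ≤ Λ ^ (1 / 2 : ℝ) * (a * Λ ^ (1 / 2 : ℝ)) := by gcongr
      _ = a * (Λ ^ (1 / 2 : ℝ) * Λ ^ (1 / 2 : ℝ)) := by ring
      _ = a * Λ := by rw [← Real.rpow_add hΛ0]; norm_num
  have hΛsq : Λ ≤ Real.logb 2 (D n) ^ 2 := by
    calc Λ = (Λ ^ (1 / 2 : ℝ)) ^ 2 := by
          rw [← Real.rpow_natCast, ← Real.rpow_mul hΛ0.le]; norm_num
      _ ≤ _ := by gcongr
  have hlD : 0 ≤ Real.logb 2 (D n) := Real.logb_nonneg (by norm_num) hD1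
  refine exists_dict_of_bounds hA (a := a) (b := b') (ε := ε) (x := μ) hn
    (by exact_mod_cast hD1) hκ1 hK hε0.le hε1 hb0 hΛ1 hκμ hμΛ ?_ ?_ hγ.2 ?_ hl ?_ hKΛ ?_ ?_
  · calc (D n : ℝ) ^ (κ n + 1) ≤ ((n : ℝ) ^ (b / ((κ n : ℝ) + 1))) ^ (κ n + 1) := by
          gcongr
          exact hD.2
      _ = (n : ℝ) ^ b := by
          rw [← Real.rpow_natCast, ← Real.rpow_mul hn0.le]
          congr 1
          push_cast
          field_simp
      _ ≤ (n : ℝ) ^ b' := Real.rpow_le_rpow_of_exponent_le hn1 hbb'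
  · linarith
  · calc 8 * (2 + 2 * Real.logb 2 (D n)) * Λ ^ 2
        ≤ 8 * (2 + 2 * Real.logb 2 (D n)) * (Real.logb 2 (D n) ^ 2) ^ 2 := by gcongr
      _ < 2 ^ Real.logb 2 (D n : ℝ) := hl₀ _ ((le_max_left _ _).trans (hΛl.trans hΛsqrt))
      _ = D n := Real.rpow_logb (by norm_num) (by norm_num) (by linarith)
  · have h1 : Λ = 2 ^ μ := (Real.rpow_logb (by norm_num) (by norm_num) hΛ0).symm
    have h2 : μ = 2 ^ ν := (Real.rpow_logb (by norm_num) (by norm_num) (by linarith)).symm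
    calc μ ^ 2 = 2 ^ (ν * 2) := by
          rw [Real.rpow_mul (by norm_num), ← h2]; norm_num
      _ ≤ 2 ^ (μ * (1 / (4 * (κ n : ℝ)))) := by
          refine Real.rpow_le_rpow_of_exponent_le (by norm_num) ?_
          rw [mul_one_div, le_div_iff₀ (by positivity)]
          linarith
      _ = Λ ^ (1 / (4 * (κ n : ℝ))) := by rw [Real.rpow_mul (by norm_num), ← h1]
  · rw [div_le_iff₀ (by positivity)] at hμa
    linarith
  · refine (le_abs_self _).trans (hq.trans (le_of_eq ?_))
    rw [Real.norm_of_nonneg (by positivity)]
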